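/- An ideal on $\mathbb N$ is a family $\mathcal I$ of subsets of $\mathbb N$ that is closed under finite unions and under taking subsets, contains every finite subset of $\mathbb N$, and does not contain $\mathbb N$. It has the Baire property if, as a subset of $\{0,1\}^{\mathbb N}$ with the product topology (sets being identified with their characteristic functions), it is the symmetric difference of an open set and a meager set. A sequence $(y_n)$ in a normed space is $\mathcal I$-bounded if there is $M>0$ with $\{n\in\mathbb N:\|y_n\|>M\}\in\mathcal I$. Let $S$ be the set of all strictly increasing sequences $s:\mathbb N\to\mathbb N$ and $P$ the set of all bijections $p:\mathbb N\to\mathbb N$, both with the subspace topology of $\mathbb N^{\mathbb N}$ (product of discrete spaces). For a series $\sum x_n$ in a Banach space put $$E(\mathcal I,(x_n))=\Big\{s\in S:\Big(\sum_{i=1}^n x_{s(i)}\Big)_n\text{ is }\mathcal I\text{-bounded}\Big\},\qquad F(\mathcal I,(x_n))=\Big\{p\in P:\Big(\sum_{i=1}^n x_{p(i)}\Big)_n\text{ is }\mathcal I\text{-bounded}\Big\}.$$ Theorem. Let $\mathcal I$ be an ideal on $\mathbb N$ with the Baire property, and let $X$ be a (real or complex) Banach space. Then $X$ contains no isomorphic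 copy of $c_0$ if and only if for every series $\sum x_n$ in $X$ with $\liminf_n\|x_n\|=0$ which is not unconditionally convergent (that is, some rearrangement $\sum x_{p(n)}$, $p\in P$, does not converge), the set $E(\mathcal I,(x_n))$ is meager in $S$ and the set $F(\mathcal I,(x_n))$ is meager in $P$. -/

import Mathlib

open Filter Topology
open scoped ZeroAtInfty

namespace IdealSeries

/-- The Cantor space copy of a family of subsets of `ℕ` (sets are identified with their
characteristic functions; `Bool` is discrete and `ℕ → Bool` has the product topology). -/
def cantorCode (I : Order.Ideal (Set ℕ)) : Set (ℕ → Bool) :=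
  {t | {n : ℕ | t n = true} ∈ I}

/-- The ideal has the Baire property, as a subset of `{0,1}^ℕ`. -/
def HasBaireProperty (I : Order.Ideal (Set ℕ)) : Prop :=
  BaireMeasurableSet (cantorCode I)

/-- `I`-boundedness of a sequence in a normed space. -/
def IsIdealBounded {X : Type*} [NormedAddCommGroup X] (I : Order.Ideal (Set ℕ)) (y : ℕ → X) :
    Prop :=
  ∃ M : ℝ, 0 < M ∧ {n : ℕ | M < ‖y n‖} ∈ I

/-- The space `S` of (strictly) increasing sequences of naturals, a subspace of `ℕ^ℕ`. -/
abbrev IncSeq : Type := {s : ℕ → ℕ // StrictMono s}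

/-- The space `P` of bijections of `ℕ`, a subspace of `ℕ^ℕ`. -/
abbrev PermSeq : Type := {p : ℕ → ℕ // Function.Bijective p}

/-- The sequence of nonempty partial sums `y 0, y 0 + y 1, …` of the series with terms `y`. -/
def partialSums {X : Type*} [NormedAddCommGroup X] (y : ℕ → X) (n : ℕ) : X :=
  ∑ i ∈ Finset.range (n + 1), y i

/-- The subseries with `I`-bounded partial sums. -/
def E {X : Type*} [NormedAddCommGroup X] (I : Order.Ideal (Set ℕ)) (x : ℕ → X) : Set IncSeq :=
  {s | IsIdealBounded I (partialSums fun i => x (s.1 i))}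

/-- The rearrangements with `I`-bounded partial sums. -/
def F {X : Type*} [NormedAddCommGroup X] (I : Order.Ideal (Set ℕ)) (x : ℕ → X) : Set PermSeq :=
  {p | IsIdealBounded I (partialSums fun i => x (p.1 i))}

/-- Unconditional convergence: every rearrangement of the series converges. -/
def UnconditionallyConvergent {X : Type*} [NormedAddCommGroup X] (x : ℕ → X) : Prop :=
  ∀ p : PermSeq, ∃ a : X, Tendsto (partialSums fun i => x (p.1 i)) atTop (𝓝 a)

/-- `X` contains an isomorphic copy of `c₀`: some linear subspace of `X` is linearly homeomorphic
to the space of scalar sequences tending to zero with the sup norm. -/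
def ContainsCZero (𝕜 X : Type*) [RCLike 𝕜] [NormedAddCommGroup X] [NormedSpace 𝕜 X] : Prop :=
  ∃ Y : Submodule 𝕜 X, Nonempty (C₀(ℕ, 𝕜) ≃L[𝕜] Y)

end IdealSeries

/-! Everything hinges on whether the finite sums of the series are bounded. Without a copy of `c₀`,
bounded finite sums force summability (`summable_of_norm_sum_le`), hence unconditional convergence;
so here they are unbounded. A proper ideal with the Baire property is meagre, and then `ℕ` splits
into intervals only finitely many of which lie inside any given member
(`exists_interval_partition`). Unboundedness and `liminf ‖x n‖ = 0` let any finite initial segment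
be continued so that the partial sums stay above `M` on a whole late interval. Generic sequences do
so for every `M` on infinitely many intervals, so they are not `I`-bounded. Conversely, the unit
vectors of a copy of `c₀`, interlaced with zeros, have bounded finite sums without converging; then
`E` is all of the Baire space `IncSeq`. -/

namespace IdealSeries

/-! ### Category in the Cantor space and ideals -/

/-- Coordinatewise exclusive or with a fixed `0`-`1` sequence, as a homeomorphism. -/
def flip (a : ℕ → Bool) : (ℕ → Bool) ≃ₜ (ℕ → Bool) where
  toFun t n := xor (t n) (a n)
  invFun t n := xor (t n) (a n)
  left_inv t := by funext n; simp
  right_inv t := by funext n; simp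
  continuous_toFun := continuous_pi fun n =>
    (continuous_of_discreteTopology (f := fun b : Bool => xor b (a n))).comp (continuous_apply n)
  continuous_invFun := continuous_pi fun n =>
    (continuous_of_discreteTopology (f := fun b : Bool => xor b (a n))).comp (continuous_apply n)

theorem flip_apply (a t : ℕ → Bool) (n : ℕ) : flip a t n = xor (t n) (a n) := rfl

theorem flip_flip (a t : ℕ → Bool) : flip a (flip a t) = t := (flip a).left_inv t

theorem flip_preimage_mem_residual (a : ℕ → Bool) {s : Set (ℕ → Bool)}
    (hs : s ∈ residual (ℕ → Bool)) : flip a ⁻¹' s ∈ residual (ℕ → Bool) := by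
  rw [← mem_map, (flip a).residual_map_eq]
  exact hs

/-- A neighbourhood in a countable product of discrete spaces contains a cylinder. -/
theorem exists_cylinder_subset {α : Type*} [TopologicalSpace α] [DiscreteTopology α]
    {q : ℕ → α} {U : Set (ℕ → α)} (hU : U ∈ 𝓝 q) :
    ∃ m, ∀ q' : ℕ → α, (∀ i < m, q' i = q i) → q' ∈ U := by
  obtain ⟨V, hVU, hV, hq⟩ := mem_nhds_iff.1 hU
  obtain ⟨v, ⟨y, n, rfl⟩, hqv, hv⟩ :=
    (PiNat.isTopologicalBasis_cylinders (fun _ : ℕ => α)).exists_subset_of_mem_open hq hV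
  refine ⟨n, fun q' h => hVU (hv ?_)⟩
  rw [PiNat.mem_cylinder_iff] at hqv ⊢
  exact fun i hi => (h i hi).trans (hqv i hi)

/-- A proper ideal with the Baire property is meagre. -/
theorem isMeagre_cantorCode {I : Order.Ideal (Set ℕ)} (hI : Set.univ ∉ I)
    (hfin : ∀ A : Set ℕ, A.Finite → A ∈ I) (hB : HasBaireProperty I) :
    IsMeagre (cantorCode I) := by
  obtain ⟨U, hU, hIU⟩ := BaireMeasurableSet.iff_residualEq_isOpen.1 hB
  rcases U.eq_empty_or_nonempty with rfl | ⟨q, hq⟩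
  · filter_upwards [hIU] with t ht
    intro h
    exact ht.mp h
  exfalso
  obtain ⟨m, hm⟩ := exists_cylinder_subset (hU.mem_nhds hq)
  -- Complementing beyond `m` preserves both the cylinder and residuality, so some `t` and its flip
  -- both code members of `I`. Their union contains every index from `m` on.
  set a : ℕ → Bool := fun n => decide (m ≤ n) with ha
  have hV : IsOpen (PiNat.cylinder q m) := PiNat.isOpen_cylinder _ q m
  obtain ⟨t, htq, ht1, ht2⟩ := (dense_of_mem_residual
    (inter_mem hIU (flip_preimage_mem_residual a hIU))).inter_open_nonempty _ hV
    ⟨q, PiNat.self_mem_cylinder q m⟩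
  rw [PiNat.mem_cylinder_iff] at htq
  have h1 : t ∈ cantorCode I := ht1.mpr (hm t htq)
  have h2 : flip a t ∈ cantorCode I := by
    refine Eq.mpr ht2 (hm _ fun i hi => ?_)
    simp [flip_apply, ha, htq i hi, not_le.2 hi]
  refine hI (I.lower ?_ (I.sup_mem (I.sup_mem h1 h2) (hfin _ (Set.finite_Iio m))))
  intro i _
  rcases lt_or_ge i m with h | h
  · exact Or.inr h
  · refine Or.inl ?_
    by_cases hti : t i = true
    · exact Or.inl hti
    · refine Or.inr ?_
      simp [flip_apply, ha, h, hti]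

/-- An open dense subset of the Cantor space contains all points which follow a suitable finite
pattern placed beyond any given position. -/
theorem exists_pattern {D : Set (ℕ → Bool)} (hD : IsOpen D) (hd : Dense D) (n : ℕ) :
    ∃ m, n < m ∧ ∃ y : ℕ → Bool, ∀ x : ℕ → Bool,
      (∀ i, n ≤ i → i < m → x i = y i) → x ∈ D := by
  set a : Finset ℕ → ℕ → Bool := fun s i => decide (i ∈ s)
  -- Points that stay in `D` under every change of coordinates below `n`; the pattern is then
  -- independent of what precedes it.
  set W : Set (ℕ → Bool) := ⋂ s ∈ (Finset.range n).powerset, flip (a s) ⁻¹' D with hW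
  have hWo : IsOpen W := isOpen_biInter_finset fun s _ => hD.preimage (flip (a s)).continuous
  have hWr : W ∈ residual (ℕ → Bool) := (biInter_finset_mem _).2 fun s _ =>
    flip_preimage_mem_residual _ (residual_of_dense_open hD hd)
  obtain ⟨y, hy⟩ := (dense_of_mem_residual hWr).nonempty
  obtain ⟨m, hm⟩ := exists_cylinder_subset (hWo.mem_nhds hy)
  refine ⟨max m (n + 1), by omega, y, fun x hx => ?_⟩
  set s := (Finset.range n).filter fun i => x i ≠ y i with hs
  have hxW : flip (a s) x ∈ W := by
    refine hm _ fun i hi => ?_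
    by_cases hin : i < n
    · by_cases h : x i = y i
      · simp [flip_apply, a, hs, h]
      · simp only [flip_apply, a, hs, Finset.mem_filter, Finset.mem_range, hin]
        revert h
        cases x i <;> cases y i <;> simp
    · have := hx i (by omega) (by omega)
      simp [flip_apply, a, hs, this]
  have := Set.mem_iInter₂.1 hxW s (Finset.mem_powerset.2 (Finset.filter_subset _ _))
  rwa [Set.mem_preimage, flip_flip] at this

/-- For a meagre ideal there is a partition of `ℕ` into intervals such that each member of the
ideal contains only finitely many of them. -/
theorem exists_interval_partition {I : Order.Ideal (Set ℕ)} (hI : IsMeagre (cantorCode I)) :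
    ∃ n : ℕ → ℕ, StrictMono n ∧ ∀ A ∈ I, ∃ K, ∀ k ≥ K, ∃ i, n k ≤ i ∧ i < n (k + 1) ∧ i ∉ A := by
  obtain ⟨t, htI, htG, htd⟩ := mem_residual.1 hI
  obtain ⟨f, hfo, rfl⟩ := isGδ_iff_eq_iInter_nat.1 htG
  set D : ℕ → Set (ℕ → Bool) := fun k => ⋂ i ∈ Finset.range (k + 1), f i with hD
  have hDo : ∀ k, IsOpen (D k) := fun k => isOpen_biInter_finset fun i _ => hfo i
  have hDd : ∀ k, Dense (D k) := fun k => htd.mono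
    (Set.subset_iInter₂ fun i _ => Set.iInter_subset f i)
  choose m hm y hy using fun k n => exists_pattern (hDo k) (hDd k) n
  set n : ℕ → ℕ := fun k => Nat.rec 0 (fun k r => m k r) k
  have hn : ∀ k, n (k + 1) = m k (n k) := fun k => rfl
  have hmono : StrictMono n := strictMono_nat_of_lt_succ fun k => hm k (n k)
  refine ⟨n, hmono, fun A hA => ?_⟩
  by_contra! hcon
  classical
  -- Copy the patterns on exactly those intervals contained in `A`. The result codes a subset of
  -- `A`, yet infinitely many copied patterns put it in every `f j`, hence outside the ideal.
  set x : ℕ → Bool := fun i => decide (∃ k, (∀ j, n k ≤ j → j < n (k + 1) → j ∈ A) ∧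
    n k ≤ i ∧ i < n (k + 1) ∧ y k (n k) i = true) with hx
  have hxI : x ∈ cantorCode I := by
    refine I.lower (fun i hi => ?_) hA
    obtain ⟨k, h1, h2, h3, -⟩ := of_decide_eq_true (Set.mem_ofPred_eq ▸ hi)
    exact h1 i h2 h3
  refine htI (Set.mem_iInter.2 fun j => ?_) hxI
  obtain ⟨k, hk, hkA⟩ := hcon j
  have hxD : x ∈ D k := by
    refine hy k (n k) x fun i h1 h2 => ?_
    rw [← hn] at h2
    rw [hx, Bool.eq_iff_iff, decide_eq_true_iff]
    constructor
    · rintro ⟨l, -, h3, h4, h5⟩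
      have e1 : k < l + 1 := hmono.lt_iff_lt.1 (h1.trans_lt h4)
      have e2 : l < k + 1 := hmono.lt_iff_lt.1 (h3.trans_lt h2)
      obtain rfl : k = l := by omega
      exact h5
    · exact fun h => ⟨k, hkA, h1, h2, h⟩
  exact Set.mem_iInter₂.1 hxD j (Finset.mem_range.2 (by omega))

/-! ### Continuing finite initial segments -/

/-- The sequence which follows `u` for `m` steps and then runs through `v`. -/
def splice {α : Type*} (u : ℕ → α) (m : ℕ) (v : ℕ → α) (i : ℕ) : α :=
  if i < m then u i else v (i - m)

section Splice

variable {α : Type*} (u v : ℕ → α) (m : ℕ)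

theorem splice_of_lt {i : ℕ} (h : i < m) : splice u m v i = u i := if_pos h

theorem splice_add (j : ℕ) : splice u m v (m + j) = v j := by simp [splice]

theorem sum_splice {X : Type*} [AddCommMonoid X] (g : α → X) (l : ℕ) :
    ∑ i ∈ Finset.range (m + l), g (splice u m v i) =
      ∑ i ∈ Finset.range m, g (u i) + ∑ j ∈ Finset.range l, g (v j) := by
  rw [Finset.sum_range_add]
  congr 1
  · exact Finset.sum_congr rfl fun i hi => by rw [splice_of_lt _ _ _ (Finset.mem_range.1 hi)]
  · simp only [splice_add]

end Splice

theorem strictMono_splice {u v : ℕ → ℕ} {m : ℕ} (hu : StrictMono u) (hv : StrictMono v)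
    (h : ∀ i < m, u i < v 0) : StrictMono (splice u m v) := by
  intro i j hij
  unfold splice
  split_ifs with hi hj hj
  · exact hu hij
  · exact (h i hi).trans_le (hv.monotone (Nat.zero_le _))
  · omega
  · exact hv (by omega)

theorem injective_splice {u v : ℕ → ℕ} {m : ℕ} (hu : Function.Injective u) (hv : StrictMono v)
    (h : ∀ i < m, u i < v 0) : Function.Injective (splice u m v) := by
  have key : ∀ i j, i < m → u i ≠ v j := fun i j hi =>
    ((h i hi).trans_le (hv.monotone (Nat.zero_le _))).ne
  intro i j hij
  unfold splice at hij
  split_ifs at hij with hi hj hj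
  · exact hu hij
  · exact absurd hij (key _ _ hi)
  · exact absurd hij.symm (key _ _ hj)
  · have := hv.injective hij
    omega

theorem exists_strictMono_image_range_eq (N : ℕ) (G : Finset ℕ) (hG : ∀ a ∈ G, N ≤ a) :
    ∃ u : ℕ → ℕ, StrictMono u ∧ N ≤ u 0 ∧ (Finset.range G.card).image u = G := by
  induction G using Finset.induction_on_max with
  | empty => exact ⟨fun i => N + i, fun i j h => Nat.add_lt_add_left h N, le_rfl, by simp⟩
  | insert a G hmax ih =>
    obtain ⟨u, hu, hN, himg⟩ := ih fun b hb => hG b (Finset.mem_insert_of_mem hb)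
    have hmem : ∀ i < G.card, u i ∈ G := fun i hi => by
      have := Finset.mem_image_of_mem u (Finset.mem_range.2 hi)
      rwa [himg] at this
    refine ⟨splice u G.card fun i => a + i, strictMono_splice hu
      (fun i j h => Nat.add_lt_add_left h a) fun i hi => hmax _ (hmem i hi), ?_, ?_⟩
    · unfold splice
      split_ifs
      · exact hN
      · exact (hG a (Finset.mem_insert_self a G)).trans (Nat.le_add_right _ _)
    · rw [Finset.card_insert_of_notMem fun h => (hmax a h).false, Finset.range_add_one,
        Finset.image_insert]
      congr 1
      · exact splice_add u (fun i => a + i) _ 0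
      · conv_rhs => rw [← himg]
        exact Finset.image_congr fun i hi => splice_of_lt _ _ _ (Finset.mem_range.1 hi)

/-- An injective sequence agrees with a permutation on any initial segment. -/
theorem exists_bijective_eq_of_injective {u : ℕ → ℕ} (hu : Function.Injective u) (L : ℕ) :
    ∃ p : ℕ → ℕ, Function.Bijective p ∧ ∀ i < L, p i = u i := by
  induction L with
  | zero => exact ⟨id, Function.bijective_id, fun i hi => absurd hi (Nat.not_lt_zero i)⟩
  | succ L ih =>
    obtain ⟨p, hp, h⟩ := ih
    refine ⟨Equiv.swap (p L) (u L) ∘ p, (Equiv.bijective _).comp hp, fun i hi => ?_⟩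
    rcases Nat.lt_succ_iff_lt_or_eq.1 hi with hi | rfl
    · rw [Function.comp_apply, Equiv.swap_apply_of_ne_of_ne (hp.1.ne hi.ne), h i hi]
      rw [h i hi]
      exact hu.ne hi.ne
    · exact Equiv.swap_apply_left _ _

/-! ### Meagreness of `E` and `F` -/

section Meagre

variable {X : Type*} [NormedAddCommGroup X]

/-- If the finite sums of a series are unbounded and its terms are frequently small, then beyond
any index there is a subseries whose partial sums stay large from some point on. -/
theorem exists_strictMono_lt_norm_sum {x : ℕ → X} (hx : ∀ ε > 0, ∃ᶠ k in atTop, ‖x k‖ < ε)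
    (hub : ∀ C : ℝ, ∃ G : Finset ℕ, C < ‖∑ i ∈ G, x i‖) (N : ℕ) (M : ℝ) :
    ∃ w : ℕ → ℕ, StrictMono w ∧ N ≤ w 0 ∧
      ∃ l, ∀ n ≥ l, M < ‖∑ i ∈ Finset.range n, x (w i)‖ := by
  -- The sum over indices below `N` pays for discarding them; the extra `1` pays for the tail `v`,
  -- whose norms are dominated by a geometric series of sum `1`.
  obtain ⟨G', hG'⟩ := hub (M + 1 + ∑ i ∈ Finset.range N, ‖x i‖)
  set G := G'.filter fun i => ¬ i < N with hG
  have hGM : M + 1 < ‖∑ i ∈ G, x i‖ := by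
    have h1 := norm_add_le (∑ i ∈ G'.filter fun i => i < N, x i) (∑ i ∈ G, x i)
    rw [Finset.sum_filter_add_sum_filter_not] at h1
    have h2 : ‖∑ i ∈ G'.filter fun i => i < N, x i‖ ≤ ∑ i ∈ Finset.range N, ‖x i‖ :=
      (norm_sum_le _ _).trans (Finset.sum_le_sum_of_subset_of_nonneg
        (fun i hi => Finset.mem_range.2 (Finset.mem_filter.1 hi).2) fun _ _ _ => norm_nonneg _)
    linarith
  obtain ⟨u, hu, hNu, himg⟩ := exists_strictMono_image_range_eq N G fun a ha =>
    not_lt.1 (Finset.mem_filter.1 ha).2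
  obtain ⟨v, hv, hvx⟩ := extraction_forall_of_frequently
    (P := fun n k => ‖x k‖ < 1 / 2 / 2 ^ n ∧ max N (u G.card) < k) fun n =>
      (hx (1 / 2 / 2 ^ n) (by positivity)).and_eventually (eventually_gt_atTop _)
  have hv0 := (hvx 0).2
  refine ⟨splice u G.card v, strictMono_splice hu hv fun i hi => (hu hi).trans (by omega), ?_,
    G.card, fun n hn => ?_⟩
  · unfold splice
    split_ifs
    · exact hNu
    · exact (le_max_left _ _).trans (hvx _).2.le
  obtain ⟨l, rfl⟩ := Nat.exists_eq_add_of_le hn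
  rw [sum_splice, ← Finset.sum_image (f := x) hu.injective.injOn, himg]
  have h1 : ‖∑ j ∈ Finset.range l, x (v j)‖ ≤ 1 := by
    refine (norm_sum_le _ _).trans ((Finset.sum_le_sum fun j _ => (hvx j).1.le).trans ?_)
    refine (Summable.sum_le_tsum _ (fun j _ => by positivity) (summable_geometric_two' 1)).trans ?_
    rw [tsum_geometric_two']
  have h2 := norm_sub_norm_le (∑ i ∈ G, x i) (-∑ j ∈ Finset.range l, x (v j))
  rw [norm_neg, sub_neg_eq_add] at h2
  linarith

/-- Meagreness of the set of sequences with `I`-bounded partial sums, from the possibility of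
extending finite initial segments so that long blocks of partial sums are large. -/
theorem isMeagre_setOf_isIdealBounded {I : Order.Ideal (Set ℕ)} (hI : IsMeagre (cantorCode I))
    {x : ℕ → X} {Q : (ℕ → ℕ) → Prop}
    (H : ∀ q, Q q → ∀ (m : ℕ) (M : ℝ), ∃ l, ∀ L, ∃ q', Q q' ∧ (∀ i < m, q' i = q i) ∧
      ∀ n, l ≤ n → n < L → M < ‖partialSums (fun i => x (q' i)) n‖) :
    IsMeagre {q : {q : ℕ → ℕ // Q q} | IsIdealBounded I (partialSums fun i => x (q.1 i))} := by
  obtain ⟨n, hn, hpart⟩ := exists_interval_partition hI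
  set D : ℕ → ℕ → Set {q : ℕ → ℕ // Q q} := fun M K => ⋃ k, ⋃ _ : K ≤ k,
    ⋂ i ∈ Finset.Ico (n k) (n (k + 1)),
      {q | (M : ℝ) < ‖partialSums (fun i => x (q.1 i)) i‖} with hD
  have hDo : ∀ M K, IsOpen (D M K) := fun M K => by
    refine isOpen_iUnion fun k => isOpen_iUnion fun _ => isOpen_biInter_finset fun i _ =>
      isOpen_lt continuous_const (Continuous.norm ?_)
    exact continuous_finsetSum _ fun j _ =>
      (continuous_of_discreteTopology (f := x)).comp
        ((continuous_apply j).comp continuous_subtype_val)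
  have hDd : ∀ M K, Dense (D M K) := fun M K => by
    refine dense_iff_inter_open.2 fun U hU ⟨q, hq⟩ => ?_
    obtain ⟨V, hV, rfl⟩ := isOpen_induced_iff.1 hU
    obtain ⟨m, hm⟩ := exists_cylinder_subset (hV.mem_nhds hq)
    -- Since `l` does not depend on `L`, the interval can be chosen beyond `l` first and `L` taken
    -- to be its right end.
    obtain ⟨l, hl⟩ := H q.1 q.2 m M
    set k := max K l
    obtain ⟨q', hQ, hag, hlarge⟩ := hl (n (k + 1))
    refine ⟨⟨q', hQ⟩, hm q' hag, Set.mem_iUnion₂.2 ⟨k, le_max_left _ _,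
      Set.mem_iInter₂.2 fun i hi => ?_⟩⟩
    rw [Finset.mem_Ico] at hi
    exact hlarge i (((le_max_right K l).trans hn.le_apply).trans hi.1) hi.2
  have hres : (⋂ M, ⋂ K, D M K) ∈ residual {q : ℕ → ℕ // Q q} :=
    countable_iInter_mem.2 fun M => countable_iInter_mem.2 fun K =>
      residual_of_dense_open (hDo M K) (hDd M K)
  refine mem_of_superset hres fun q hq => ?_
  rintro ⟨M, -, hM⟩
  obtain ⟨M', hM'⟩ := exists_nat_ge M
  obtain ⟨K, hK⟩ := hpart _ hM
  obtain ⟨k, hk, hmem⟩ := Set.mem_iUnion₂.1 (Set.mem_iInter₂.1 hq M' K)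
  obtain ⟨i, h1, h2, h3⟩ := hK k hk
  exact h3 (hM'.trans_lt (Set.mem_iInter₂.1 hmem i (Finset.mem_Ico.2 ⟨h1, h2⟩)))

/-- Any injective initial segment can be continued by a strictly increasing sequence of large
indices so that the partial sums stay large from some point on. -/
theorem exists_splice_lt_norm_partialSums {x : ℕ → X}
    (hx : ∀ ε > 0, ∃ᶠ k in atTop, ‖x k‖ < ε)
    (hub : ∀ C : ℝ, ∃ G : Finset ℕ, C < ‖∑ i ∈ G, x i‖) (q : ℕ → ℕ) (m : ℕ) (M : ℝ) :
    ∃ w : ℕ → ℕ, StrictMono w ∧ (∀ i < m, q i < w 0) ∧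
      ∃ l, ∀ n ≥ l, M < ‖partialSums (fun i => x (splice q m w i)) n‖ := by
  obtain ⟨w, hw, hN, l, hl⟩ := exists_strictMono_lt_norm_sum hx hub
    ((Finset.range m).sup q + 1) (M + ‖∑ i ∈ Finset.range m, x (q i)‖)
  refine ⟨w, hw, fun i hi => ?_, m + l, fun n hn => ?_⟩
  · have := Finset.le_sup (f := q) (Finset.mem_range.2 hi)
    omega
  · obtain ⟨j, hj⟩ := Nat.exists_eq_add_of_le (show m ≤ n + 1 by omega)
    rw [partialSums, hj, sum_splice]
    have h1 := hl j (by omega)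
    have h2 := norm_sub_norm_le (∑ i ∈ Finset.range j, x (w i))
      (-∑ i ∈ Finset.range m, x (q i))
    rw [norm_neg, sub_neg_eq_add, add_comm] at h2
    linarith

theorem isMeagre_E {I : Order.Ideal (Set ℕ)} (hI : IsMeagre (cantorCode I)) {x : ℕ → X}
    (hx : ∀ ε > 0, ∃ᶠ k in atTop, ‖x k‖ < ε)
    (hub : ∀ C : ℝ, ∃ G : Finset ℕ, C < ‖∑ i ∈ G, x i‖) : IsMeagre (E I x) := by
  refine isMeagre_setOf_isIdealBounded hI fun q hq m M => ?_
  obtain ⟨w, hw, hqw, l, hl⟩ := exists_splice_lt_norm_partialSums hx hub q m M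
  exact ⟨l, fun L => ⟨splice q m w, strictMono_splice hq hw hqw,
    fun i hi => splice_of_lt _ _ _ hi, fun n hn _ => hl n hn⟩⟩

theorem isMeagre_F {I : Order.Ideal (Set ℕ)} (hI : IsMeagre (cantorCode I)) {x : ℕ → X}
    (hx : ∀ ε > 0, ∃ᶠ k in atTop, ‖x k‖ < ε)
    (hub : ∀ C : ℝ, ∃ G : Finset ℕ, C < ‖∑ i ∈ G, x i‖) : IsMeagre (F I x) := by
  refine isMeagre_setOf_isIdealBounded hI fun q hq m M => ?_
  obtain ⟨w, hw, hqw, l, hl⟩ := exists_splice_lt_norm_partialSums hx hub q m M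
  refine ⟨l, fun L => ?_⟩
  -- The spliced sequence need not be onto, but only its first `max m L` values matter.
  obtain ⟨p, hp, hpw⟩ :=
    exists_bijective_eq_of_injective (injective_splice hq.1 hw hqw) (max m L)
  refine ⟨p, hp, fun i hi => ?_, fun n hn hnL => ?_⟩
  · rw [hpw i (lt_max_of_lt_left hi), splice_of_lt _ _ _ hi]
  · have : partialSums (fun i => x (p i)) n = partialSums (fun i => x (splice q m w i)) n :=
      Finset.sum_congr rfl fun i hi => by
        beta_reduce
        rw [hpw i (lt_max_of_lt_right (by have := Finset.mem_range.1 hi; omega))]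
    rw [this]
    exact hl n hn

end Meagre

/-! ### Copies of `c₀` from bounded finite sums -/

/-- Rosenthal's disjointification lemma for matrices with bounded row sums. -/
theorem exists_injective_offDiag_sum_le {δ : ℝ} (hδ : 0 < δ) (n : ℕ) (a : ℕ → ℕ → ℝ)
    (ha : ∀ k j, 0 ≤ a k j) (hn : ∀ k, ∀ J : Finset ℕ, ∑ j ∈ J, a k j ≤ n * δ) :
    ∃ φ : ℕ → ℕ, Function.Injective φ ∧
      ∀ k, ∀ J : Finset ℕ, k ∉ J → ∑ j ∈ J, a (φ k) (φ j) ≤ δ := by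
  induction n generalizing a with
  | zero =>
    refine ⟨id, Function.injective_id, fun k J _ => (hn k J).trans ?_⟩
    simp [hδ.le]
  | succ n ih =>
    -- Pairing splits `ℕ` into infinitely many infinite blocks. If every block fails, each has a row
    -- carrying mass above `δ` in its own block, off the chosen indices `ψ`; restricted to `ψ`, row
    -- sums drop by `δ`.
    by_cases hgood : ∃ p, ∀ k, ∀ J : Finset ℕ, k ∉ J →
        ∑ j ∈ J, a (Nat.pair p k) (Nat.pair p j) ≤ δ
    · obtain ⟨p, hp⟩ := hgood
      exact ⟨Nat.pair p, fun i j h => (Nat.pair_eq_pair.1 h).2, hp⟩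
    · push Not at hgood
      choose k J hkJ hlt using hgood
      set ψ : ℕ → ℕ := fun p => Nat.pair p (k p) with hψ
      have hψi : Function.Injective ψ := fun i j h => (Nat.pair_eq_pair.1 h).1
      obtain ⟨φ, hφ, h⟩ := ih (fun p q => a (ψ p) (ψ q)) (fun _ _ => ha _ _) (fun p G => by
        have hdisj : Disjoint (G.image ψ) ((J p).image (Nat.pair p)) := by
          rw [Finset.disjoint_left]
          intro i hi hi'
          obtain ⟨q, -, rfl⟩ := Finset.mem_image.1 hi
          obtain ⟨j, hj, hq⟩ := Finset.mem_image.1 hi'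
          obtain ⟨rfl, rfl⟩ := Nat.pair_eq_pair.1 hq
          exact hkJ _ hj
        have h1 := hn (ψ p) (G.image ψ ∪ (J p).image (Nat.pair p))
        rw [Finset.sum_union hdisj, Finset.sum_image hψi.injOn,
          Finset.sum_image fun i _ j _ h => (Nat.pair_eq_pair.1 h).2] at h1
        have h2 := hlt p
        push_cast at h1
        linarith)
      exact ⟨ψ ∘ φ, hψi.comp hφ, h⟩

theorem sum_abs_le_of_abs_sum_le {ι : Type*} (r : ι → ℝ) {C : ℝ}
    (h : ∀ G : Finset ι, |∑ i ∈ G, r i| ≤ C) (G : Finset ι) : ∑ i ∈ G, |r i| ≤ 2 * C := by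
  have h1 := (abs_le.1 (h (G.filter fun i => 0 ≤ r i))).2
  have h2 := (abs_le.1 (h (G.filter fun i => ¬ 0 ≤ r i))).1
  rw [← Finset.sum_filter_add_sum_filter_not G fun i => 0 ≤ r i,
    Finset.sum_congr rfl fun i hi => abs_of_nonneg (Finset.mem_filter.1 hi).2,
    Finset.sum_congr (s₁ := G.filter fun i => ¬ 0 ≤ r i) rfl fun i hi =>
      abs_of_neg (not_le.1 (Finset.mem_filter.1 hi).2), Finset.sum_neg_distrib]
  linarith

theorem sum_norm_le_of_norm_sum_le {ι 𝕜 : Type*} [RCLike 𝕜] (z : ι → 𝕜) {C : ℝ}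
    (h : ∀ G : Finset ι, ‖∑ i ∈ G, z i‖ ≤ C) (G : Finset ι) : ∑ i ∈ G, ‖z i‖ ≤ 4 * C := by
  have h1 := sum_abs_le_of_abs_sum_le (fun i => RCLike.re (z i)) (C := C)
    (fun G => by rw [← map_sum]; exact (RCLike.abs_re_le_norm _).trans (h G)) G
  have h2 := sum_abs_le_of_abs_sum_le (fun i => RCLike.im (z i)) (C := C)
    (fun G => by rw [← map_sum]; exact (RCLike.abs_im_le_norm _).trans (h G)) G
  calc ∑ i ∈ G, ‖z i‖ ≤ ∑ i ∈ G, (|RCLike.re (z i)| + |RCLike.im (z i)|) :=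
        Finset.sum_le_sum fun i _ => by
          conv_lhs => rw [← RCLike.re_add_im (z i)]
          refine (norm_add_le _ _).trans (add_le_add (by simp) ?_)
          rw [norm_mul, RCLike.norm_ofReal]
          refine mul_le_of_le_one_right (abs_nonneg _) ?_
          rcases eq_or_ne (RCLike.I : 𝕜) 0 with h0 | h0
          · simp [h0]
          · exact (RCLike.norm_I_of_ne_zero h0).le
    _ ≤ 4 * C := by rw [Finset.sum_add_distrib]; linarith

section

variable {𝕜 X : Type*} [RCLike 𝕜] [NormedAddCommGroup X] [NormedSpace 𝕜 X]

theorem sum_norm_dual_le {ι : Type*} {y : ι → X} {C : ℝ} (hC : ∀ G : Finset ι, ‖∑ i ∈ G, y i‖ ≤ C)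
    {g : StrongDual 𝕜 X} (hg : ‖g‖ ≤ 1) (G : Finset ι) : ∑ i ∈ G, ‖g (y i)‖ ≤ 4 * C :=
  sum_norm_le_of_norm_sum_le _ (fun G => by
    rw [← map_sum]
    calc ‖g (∑ i ∈ G, y i)‖ ≤ 1 * ‖∑ i ∈ G, y i‖ := g.le_of_opNorm_le hg _
      _ ≤ C := by rw [one_mul]; exact hC G) G

/-- A norming functional reduces this to absolute sums of scalars, where the coefficients come out
as `M`. -/
theorem norm_sum_smul_le {ι : Type*} {y : ι → X} {C : ℝ} (hC : ∀ G : Finset ι, ‖∑ i ∈ G, y i‖ ≤ C)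
    {a : ι → 𝕜} {M : ℝ} (G : Finset ι) (hM : 0 ≤ M) (ha : ∀ i ∈ G, ‖a i‖ ≤ M) :
    ‖∑ i ∈ G, a i • y i‖ ≤ M * (4 * C) := by
  obtain ⟨g, hg, hgv⟩ := exists_dual_vector'' 𝕜 (∑ i ∈ G, a i • y i)
  have : ‖∑ i ∈ G, a i • y i‖ = ‖g (∑ i ∈ G, a i • y i)‖ := by rw [hgv]; simp
  rw [this, map_sum]
  calc ‖∑ i ∈ G, g (a i • y i)‖ ≤ ∑ i ∈ G, ‖g (a i • y i)‖ := norm_sum_le _ _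
    _ ≤ ∑ i ∈ G, M * ‖g (y i)‖ := Finset.sum_le_sum fun i hi => by
        rw [map_smul, norm_smul]
        exact mul_le_mul_of_nonneg_right (ha i hi) (norm_nonneg _)
    _ ≤ M * (4 * C) := by
        rw [← Finset.mul_sum]
        exact mul_le_mul_of_nonneg_left (sum_norm_dual_le hC hg G) hM

theorem norm_apply_le_norm (a : C₀(ℕ, 𝕜)) (k : ℕ) : ‖a k‖ ≤ ‖a‖ := by
  rw [← ZeroAtInftyContinuousMap.norm_toBCF_eq_norm]
  exact a.toBCF.norm_coe_le_norm k

theorem norm_le_of_forall_apply {a : C₀(ℕ, 𝕜)} {M : ℝ} (hM : 0 ≤ M) (h : ∀ k, ‖a k‖ ≤ M) :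
    ‖a‖ ≤ M := by
  rw [← ZeroAtInftyContinuousMap.norm_toBCF_eq_norm]
  exact (BoundedContinuousFunction.norm_le hM).2 h

variable [CompleteSpace X]

theorem summable_smul {y : ℕ → X} {C : ℝ} (hC : ∀ G : Finset ℕ, ‖∑ i ∈ G, y i‖ ≤ C)
    (a : C₀(ℕ, 𝕜)) : Summable fun i => a i • y i := by
  rw [summable_iff_vanishing_norm]
  intro ε hε
  have hC0 : 0 ≤ C := (norm_nonneg _).trans (hC ∅)
  set η := ε / (4 * C + 1) with hη
  have hη0 : 0 < η := by positivity
  have hlim : ∀ᶠ i in cocompact ℕ, ‖a i‖ < η := by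
    have := (zero_at_infty a).norm
    rw [norm_zero] at this
    exact this.eventually_lt_const hη0
  rw [cocompact_eq_cofinite] at hlim
  have hfin : {i | ¬ ‖a i‖ < η}.Finite := hlim
  refine ⟨hfin.toFinset, fun t ht => (norm_sum_smul_le hC t hη0.le fun i hi => ?_).trans_lt ?_⟩
  · by_contra h
    exact Finset.disjoint_left.1 ht hi (hfin.mem_toFinset.2 fun h' => h h'.le)
  · rw [hη, div_mul_eq_mul_div, div_lt_iff₀ (by positivity)]
    nlinarith

/-- A sequence bounded below in norm, with bounded finite sums, spans (after passing to a
subsequence) a copy of `c₀`. -/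
theorem containsCZero_of_norm_sum_le {y : ℕ → X} {C ε : ℝ}
    (hC : ∀ G : Finset ℕ, ‖∑ i ∈ G, y i‖ ≤ C) (hε : 0 < ε) (hy : ∀ k, ε ≤ ‖y k‖) :
    ContainsCZero 𝕜 X := by
  choose f hf hfy using fun k => exists_dual_vector'' 𝕜 (y k)
  have hC0 : 0 ≤ C := (norm_nonneg _).trans (hC ∅)
  obtain ⟨n, hn⟩ := exists_nat_ge (4 * C / (ε / 2))
  obtain ⟨φ, hφ, hsum⟩ := exists_injective_offDiag_sum_le (half_pos hε) n
    (fun k j => ‖f k (y j)‖) (fun _ _ => norm_nonneg _) (fun k J =>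
      (sum_norm_dual_le hC (hf k) J).trans ((div_le_iff₀ (half_pos hε)).1 hn))
  have hC' : ∀ G : Finset ℕ, ‖∑ i ∈ G, y (φ i)‖ ≤ C := fun G => by
    rw [← Finset.sum_image (f := y) hφ.injOn]
    exact hC _
  have hs : ∀ a : C₀(ℕ, 𝕜), Summable fun i => a i • y (φ i) := summable_smul hC'
  let T : C₀(ℕ, 𝕜) →ₗ[𝕜] X :=
    { toFun := fun a => ∑' i, a i • y (φ i)
      map_add' := fun a b => by
        rw [← (hs a).tsum_add (hs b)]
        simp only [ZeroAtInftyContinuousMap.add_apply, add_smul]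
      map_smul' := fun c a => by
        rw [RingHom.id_apply, ← (hs a).tsum_const_smul]
        simp only [ZeroAtInftyContinuousMap.smul_apply, smul_assoc] }
  have hT : ∀ a, HasSum (fun i => a i • y (φ i)) (T a) := fun a => (hs a).hasSum
  have hupper : ∀ a, ‖T a‖ ≤ 4 * C * ‖a‖ := fun a => by
    refine le_of_tendsto (hT a).norm (Eventually.of_forall fun G => ?_)
    rw [mul_comm]
    exact norm_sum_smul_le hC' G (norm_nonneg a) fun i _ => norm_apply_le_norm a i
  -- Test against the functional norming `y (φ k)`: the diagonal term gives `‖a k‖ * ε`, and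
  -- disjointification keeps the rest below `‖a‖ * (ε / 2)`. Taking the supremum over `k` then
  -- absorbs the error.
  have hlow1 : ∀ a k, ‖a k‖ * ε - ‖a‖ * (ε / 2) ≤ ‖T a‖ := fun a k => by
    refine ge_of_tendsto (hT a).norm ?_
    filter_upwards [eventually_ge_atTop {k}] with G hG
    have hkG : k ∈ G := hG (Finset.mem_singleton_self k)
    have h1 : ‖f (φ k) (∑ i ∈ G, a i • y (φ i))‖ ≤ ‖∑ i ∈ G, a i • y (φ i)‖ := by
      simpa using (f (φ k)).le_of_opNorm_le (hf _) (∑ i ∈ G, a i • y (φ i))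
    refine le_trans ?_ h1
    rw [map_sum, ← Finset.add_sum_erase G _ hkG]
    have h2 : ‖a k‖ * ε ≤ ‖f (φ k) (a k • y (φ k))‖ := by
      rw [map_smul, hfy, norm_smul]
      refine mul_le_mul_of_nonneg_left ?_ (norm_nonneg _)
      simpa using hy (φ k)
    have h3 : ‖∑ i ∈ G.erase k, f (φ k) (a i • y (φ i))‖ ≤ ‖a‖ * (ε / 2) := by
      calc _ ≤ ∑ i ∈ G.erase k, ‖f (φ k) (a i • y (φ i))‖ := norm_sum_le _ _
        _ ≤ ∑ i ∈ G.erase k, ‖a‖ * ‖f (φ k) (y (φ i))‖ := Finset.sum_le_sum fun i _ => by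
            rw [map_smul, norm_smul]
            exact mul_le_mul_of_nonneg_right (norm_apply_le_norm a i) (norm_nonneg _)
        _ ≤ ‖a‖ * (ε / 2) := by
            rw [← Finset.mul_sum]
            exact mul_le_mul_of_nonneg_left (hsum k _ (Finset.notMem_erase k G)) (norm_nonneg _)
    have h4 := norm_sub_norm_le (f (φ k) (a k • y (φ k)))
      (-∑ i ∈ G.erase k, f (φ k) (a i • y (φ i)))
    rw [norm_neg, sub_neg_eq_add] at h4
    linarith
  have hlower : ∀ a, ‖a‖ ≤ 2 / ε * ‖T a‖ := fun a => by
    have h : ‖a‖ ≤ (‖T a‖ + ‖a‖ * (ε / 2)) / ε := by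
      refine norm_le_of_forall_apply (by positivity) fun k => ?_
      rw [le_div_iff₀ hε]
      linarith [hlow1 a k]
    rw [le_div_iff₀ hε] at h
    rw [div_mul_eq_mul_div, le_div_iff₀ hε]
    linarith
  have hinj : Function.Injective T := by
    rw [← LinearMap.ker_eq_bot, LinearMap.ker_eq_bot']
    intro a ha
    have := hlower a
    rw [ha, norm_zero, mul_zero] at this
    exact norm_le_zero_iff.1 this
  refine ⟨LinearMap.range T, ⟨(LinearEquiv.ofInjective T hinj).toContinuousLinearEquivOfBounds
    (4 * C) (2 / ε) hupper fun v => ?_⟩⟩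
  obtain ⟨a, rfl⟩ := (LinearEquiv.ofInjective T hinj).surjective v
  rw [LinearEquiv.symm_apply_apply]
  exact hlower a

/-- The Bessaga–Pełczyński theorem. -/
theorem summable_of_norm_sum_le (hX : ¬ ContainsCZero 𝕜 X) {x : ℕ → X} {C : ℝ}
    (hC : ∀ G : Finset ℕ, ‖∑ i ∈ G, x i‖ ≤ C) : Summable x := by
  by_contra hs
  rw [summable_iff_vanishing_norm] at hs
  push Not at hs
  obtain ⟨ε, hε, h⟩ := hs
  -- Failure of the Cauchy criterion yields disjoint blocks with sums bounded below; finite sums of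
  -- block sums are finite sums of `x`, so `C` still bounds them.
  obtain ⟨B, hB, hdisj⟩ := exists_seq_of_forall_finset_exists
    (fun G : Finset ℕ => ε ≤ ‖∑ i ∈ G, x i‖) (fun G H => Disjoint G H) (fun S _ => by
      obtain ⟨t, ht, hle⟩ := h (S.biUnion id)
      exact ⟨t, hle, fun G hG => ((Finset.disjoint_biUnion_right _ _ _).1 ht G hG).symm⟩)
  refine hX (containsCZero_of_norm_sum_le (y := fun k => ∑ i ∈ B k, x i) (C := C) (fun G => ?_)
    hε hB)
  rw [← Finset.sum_biUnion]
  · exact hC _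
  · intro i _ j _ hij
    rcases hij.lt_or_gt with h | h
    · exact hdisj i j h
    · exact (hdisj j i h).symm

end

theorem unconditionallyConvergent_of_summable {X : Type*} [NormedAddCommGroup X] {x : ℕ → X}
    (hx : Summable x) : UnconditionallyConvergent x := fun p => by
  refine ⟨∑' i, x i, ?_⟩
  have h := ((Equiv.ofBijective p.1 p.2).hasSum_iff.2 hx.hasSum).tendsto_sum_nat
  exact h.comp (tendsto_add_atTop_nat 1)

/-! ### The converse: a bad series in a space containing `c₀` -/

instance instBaireSpaceIncSeq : BaireSpace IncSeq := by
  have hlt : ∀ i j, IsClosed {s : ℕ → ℕ | s i + 1 ≤ s j} := fun i j =>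
    isClosed_le (by fun_prop) (by fun_prop)
  have h : IsClosed {s : ℕ → ℕ | StrictMono s} := by
    simp only [StrictMono, Set.ofPred_forall]
    exact isClosed_iInter fun i => isClosed_iInter fun j => isClosed_iInter fun _ => hlt i j
  have : PolishSpace IncSeq := h.polishSpace
  infer_instance

section UnitVectors

variable (𝕜 : Type*) [RCLike 𝕜]

/-- The unit vectors of `c₀`. -/
noncomputable def unitVector (n : ℕ) : C₀(ℕ, 𝕜) where
  toFun := Pi.single n 1
  continuous_toFun := continuous_of_discreteTopology
  zero_at_infty' := by
    rw [cocompact_eq_cofinite]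
    refine tendsto_const_nhds.congr' ?_
    filter_upwards [(Set.finite_singleton n).compl_mem_cofinite] with i hi
    exact (Pi.single_eq_of_ne (M := fun _ => 𝕜) hi 1).symm

theorem unitVector_apply (n k : ℕ) : unitVector 𝕜 n k = if k = n then 1 else 0 :=
  Pi.single_apply n 1 k

theorem one_le_norm_unitVector (n : ℕ) : 1 ≤ ‖unitVector 𝕜 n‖ := by
  simpa [unitVector_apply] using norm_apply_le_norm (unitVector 𝕜 n) n

theorem norm_sum_unitVector_le (G : Finset ℕ) : ‖∑ n ∈ G, unitVector 𝕜 n‖ ≤ 1 := by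
  have hsum : ∀ G : Finset ℕ, ∀ k, (∑ n ∈ G, unitVector 𝕜 n) k = if k ∈ G then 1 else 0 := by
    intro G k
    induction G using Finset.induction_on with
    | empty => simp
    | insert a G ha ih =>
      rw [Finset.sum_insert ha, ZeroAtInftyContinuousMap.add_apply, ih, unitVector_apply]
      by_cases h : k = a
      · subst h
        simp [ha]
      · simp [h]
  refine norm_le_of_forall_apply zero_le_one fun k => ?_
  rw [hsum]
  split_ifs <;> simp

end UnitVectors

variable {𝕜 X : Type*} [RCLike 𝕜] [NormedAddCommGroup X] [NormedSpace 𝕜 X]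

/-- In a space containing `c₀` there is a series with a subsequence of zero terms, which is not
unconditionally convergent although all its finite sums are uniformly bounded. -/
theorem ContainsCZero.exists_series (h : ContainsCZero 𝕜 X) :
    ∃ x : ℕ → X, liminf (fun n => ‖x n‖ₑ) atTop = 0 ∧ ¬ UnconditionallyConvergent x ∧
      ∃ C : ℝ, ∀ G : Finset ℕ, ‖∑ i ∈ G, x i‖ ≤ C := by
  obtain ⟨Y, ⟨Φ⟩⟩ := h
  set T : C₀(ℕ, 𝕜) →L[𝕜] X := Y.subtypeL.comp (Φ : C₀(ℕ, 𝕜) →L[𝕜] Y)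
  -- The zeros at odd indices give `liminf = 0`; the terms at even indices do not tend to zero, as
  -- `Φ` has a continuous inverse.
  refine ⟨fun n => if Even n then T (unitVector 𝕜 n) else 0, ?_, fun hconv => ?_, ‖T‖, fun G => ?_⟩
  · refine le_antisymm (liminf_le_of_frequently_le' ?_) bot_le
    refine frequently_atTop.2 fun N => ⟨2 * N + 1, by omega, ?_⟩
    simp
  · obtain ⟨a, ha⟩ := hconv ⟨id, Function.bijective_id⟩
    set x : ℕ → X := fun n => if Even n then T (unitVector 𝕜 n) else 0
    have h1 : Tendsto (fun n => x (n + 1)) atTop (𝓝 0) := by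
      have := (ha.comp (tendsto_add_atTop_nat 1)).sub ha
      rw [sub_self] at this
      refine this.congr fun n => ?_
      simp only [Function.comp_apply, partialSums]
      rw [Finset.sum_range_succ _ (n + 1), add_sub_cancel_left]
      rfl
    have h2 : Tendsto (fun n => x (2 * n)) atTop (𝓝 0) :=
      ((tendsto_add_atTop_iff_nat 1).1 h1).comp
        (tendsto_id.const_mul_atTop' (by norm_num : 0 < 2))
    have h3 : Tendsto (fun n => Φ (unitVector 𝕜 (2 * n))) atTop (𝓝 0) := by
      rw [tendsto_subtype_rng]
      refine h2.congr fun n => ?_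
      simp [x, T]
    have h4 := ((Φ.symm.continuous.tendsto 0).comp h3).norm
    simp only [Function.comp_def, ContinuousLinearEquiv.symm_apply_apply, map_zero,
      norm_zero] at h4
    have := ge_of_tendsto h4 (Eventually.of_forall fun n => one_le_norm_unitVector 𝕜 (2 * n))
    norm_num at this
  · rw [← Finset.sum_filter, ← map_sum]
    exact (T.le_opNorm _).trans
      (mul_le_of_le_one_right (norm_nonneg _) (norm_sum_unitVector_le 𝕜 _))

theorem E_eq_univ_of_norm_sum_le {I : Order.Ideal (Set ℕ)}
    (hI : ∀ A : Set ℕ, A.Finite → A ∈ I) {x : ℕ → X} {C : ℝ}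
    (hC : ∀ G : Finset ℕ, ‖∑ i ∈ G, x i‖ ≤ C) : E I x = Set.univ := by
  refine Set.eq_univ_of_forall fun s => ⟨max C 1, by positivity, hI _ ?_⟩
  convert Set.finite_empty (α := ℕ)
  refine Set.eq_empty_of_forall_notMem fun n hn => ?_
  refine hn.not_ge (le_trans ?_ (le_max_left C 1))
  rw [partialSums, ← Finset.sum_image (f := x) s.2.injective.injOn]
  exact hC _

end IdealSeries

theorem mainTheorem1 (I : Order.Ideal (Set ℕ)) (hI_proper : Set.univ ∉ I)
    (hI_fin : ∀ A : Set ℕ, A.Finite → A ∈ I) (hI_baire : IdealSeries.HasBaireProperty I)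
    {𝕜 X : Type*} [RCLike 𝕜] [NormedAddCommGroup X] [NormedSpace 𝕜 X] [CompleteSpace X] :
    ¬ IdealSeries.ContainsCZero 𝕜 X ↔
      ∀ x : ℕ → X, liminf (fun n => ‖x n‖ₑ) atTop = 0 →
        ¬ IdealSeries.UnconditionallyConvergent x →
          IsMeagre (IdealSeries.E I x) ∧ IsMeagre (IdealSeries.F I x) := by
  constructor
  · intro hX x hlim hnot
    have hI := IdealSeries.isMeagre_cantorCode hI_proper hI_fin hI_baire
    have hx : ∀ ε > 0, ∃ᶠ k in atTop, ‖x k‖ < ε := fun ε hε => by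
      refine (frequently_lt_of_liminf_lt (b := ENNReal.ofReal ε) (by isBoundedDefault)
        (by rw [hlim]; simpa using hε)).mono fun k hk => ?_
      rwa [← ofReal_norm, ENNReal.ofReal_lt_ofReal_iff hε] at hk
    have hub : ∀ C : ℝ, ∃ G : Finset ℕ, C < ‖∑ i ∈ G, x i‖ := by
      by_contra! hcon
      obtain ⟨C, hC⟩ := hcon
      exact hnot (IdealSeries.unconditionallyConvergent_of_summable
        (IdealSeries.summable_of_norm_sum_le hX hC))
    exact ⟨IdealSeries.isMeagre_E hI hx hub, IdealSeries.isMeagre_F hI hx hub⟩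
  · intro h hX
    obtain ⟨x, hlim, hnot, C, hC⟩ := hX.exists_series
    have hE := (h x hlim hnot).1
    rw [IdealSeries.E_eq_univ_of_norm_sum_le hI_fin hC] at hE
    exact not_isMeagre_of_isOpen isOpen_univ ⟨⟨id, strictMono_id⟩, trivial⟩ hE
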